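/- Let $K$ be a field, let $X$ and $Y$ be schemes over $K$, and let $f : X \dashrightarrow Y$ be a rational map of $K$-schemes, i.e. an equivalence class of $K$-morphisms to $Y$ defined on dense open subschemes of $X$, two such being equivalent if they agree on a dense open subscheme. Assume that $X$ has a smooth $K$-point, i.e. a section $x$ of the structure morphism $X \to \operatorname{Spec} K$ such that some open neighbourhood in $X$ of the image of $x$ is smooth over $K$, and that $Y$ is proper over $K$. Then $Y$ has a $K$-point, i.e. the structure morphism $Y \to \operatorname{Spec} K$ has a section. -/

import Mathlib

open CategoryTheory AlgebraicGeometry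

universe u

/-- A morphism of schemes `f : X ⟶ S` is smooth at a point `x` of `X` if its restriction to some
open neighbourhood of `x` is a smooth morphism. No finiteness of `f` away from `x` is assumed. -/
def AlgebraicGeometry.Scheme.Hom.IsSmoothAt {X S : Scheme.{u}} (f : X ⟶ S) (x : X) : Prop :=
  ∃ U : X.Opens, x ∈ U ∧ Smooth (U.ι ≫ f)

/-- A `K`-point of a `K`-scheme `X`: a section of the structure morphism `X ⟶ Spec K`. -/
structure AlgebraicGeometry.Scheme.RationalPoint (K : Type u) [Field K] (X : Scheme.{u})
    [X.Over (Spec (.of K))] where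
  /-- The underlying morphism of schemes. -/
  hom : Spec (.of K) ⟶ X
  hom_over : hom ≫ X ↘ Spec (.of K) = 𝟙 (Spec (.of K))

/-- The point of the underlying space of `X` which is the image of a `K`-point. -/
noncomputable def AlgebraicGeometry.Scheme.RationalPoint.point {K : Type u} [Field K] {X : Scheme.{u}}
    [X.Over (Spec (.of K))] (x : X.RationalPoint K) : X :=
  x.hom (IsLocalRing.closedPoint K)

/-! Near the smooth point, `X` has an affine chart étale over affine `n`-space. The `K`-point is
moved to a generic one by deforming one coordinate at a time: replace `t i` by `t i + X` and lift
along `L⟦X⟧ → L` by formal smoothness (`exists_algebraicIndepOn`). The resulting point, over an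
iterated Laurent series field, lies above the generic point of affine space, so it lands in every
dense open set (`ker_mem_of_dense`) and `f` can be evaluated there. Properness of `Y` then removes
the Laurent variables one by one, by extending to `L⟦X⟧` and setting `X = 0`. -/

section

open PowerSeries

/-- A translate of the variable of a power series ring is transcendental over the coefficients. -/
theorem PowerSeries.transcendental_X_add_C {R : Type*} [CommRing R] [Nontrivial R] (c : R) :
    Transcendental R (X + C c : R⟦X⟧) := by
  have h : (X + C c : R⟦X⟧) = Polynomial.coeToPowerSeries.algHom R (.X + .C c) := by simp
  rw [h, transcendental_iff]
  intro p hp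
  rw [Polynomial.aeval_algHom_apply] at hp
  have hp' : Polynomial.taylor c p = 0 := by
    apply Polynomial.coe_injective R
    simpa [Polynomial.taylor_apply, Polynomial.comp, Polynomial.aeval_def] using hp
  exact Polynomial.taylor_injective c (by simpa using hp')

theorem Transcendental.of_subalgebra_le_range {K L M : Type*} [Field K] [Field L] [Field M]
    [Algebra K L] [Algebra L M] [Algebra K M] [IsScalarTower K L M] {S : Subalgebra K M}
    (hS : S ≤ (IsScalarTower.toAlgHom K L M).range) {x : M} (hx : Transcendental L x) :
    Transcendental S x := by
  intro h
  let e := AlgEquiv.ofInjective (IsScalarTower.toAlgHom K L M) (algebraMap L M).injective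
  let f : S →+* L := (e.symm.toAlgHom.comp (Subalgebra.inclusion hS)).toRingHom
  refine hx (h.ringHom_of_comp_eq f (RingHom.id M)
    (e.symm.injective.comp (Subalgebra.inclusion_injective hS)) ?_)
  ext s
  exact congr_arg Subtype.val (e.apply_symm_apply (Subalgebra.inclusion hS s))

/-- A map from a formally smooth `R`-algebra `A` to `L` lifts to `L⟦X⟧` along any lift of its
restriction to `R`. -/
theorem Algebra.FormallySmooth.exists_powerSeries_lift {R A L : Type*} [CommRing R] [CommRing A]
    [Algebra R A] [Algebra.FormallySmooth R A] [CommRing L] (a : A →+* L) (φ : R →+* L⟦X⟧)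
    (h : (constantCoeff (R := L)).comp φ = a.comp (algebraMap R A)) :
    ∃ b : A →+* L⟦X⟧, b.comp (algebraMap R A) = φ := by
  let _ : Algebra R L⟦X⟧ := φ.toAlgebra
  let I : Ideal L⟦X⟧ := Ideal.span {X}
  let f : A →ₐ[R] L⟦X⟧ ⧸ I :=
    { ((Ideal.Quotient.mk I).comp ((C (R := L)).comp a)) with
      commutes' := fun r ↦ by
        change Ideal.Quotient.mk I (C (a (algebraMap R A r))) = Ideal.Quotient.mk I (φ r)
        rw [Ideal.Quotient.eq, Ideal.mem_span_singleton, X_dvd_iff, map_sub, sub_eq_zero]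
        simpa using (RingHom.congr_fun h r).symm }
  -- `L⟦X⟧` is `X`-adically complete, so the map modulo `X` lifts all the way.
  obtain ⟨g, -⟩ := Algebra.FormallySmooth.exists_mkₐ_comp_eq_of_isAdicComplete f
  exact ⟨g.toRingHom, g.comp_algebraMap⟩

/-- A `K`-point of a `K`-algebra `A`, formally smooth over `K[Xᵢ]`, deforms to an `L`-point at which
finitely many given `Xᵢ` become algebraically independent, where `L` is an iterated Laurent series
field over `K`. Properties of `K` that pass to Laurent series fields therefore hold for `L`. -/
theorem Algebra.FormallySmooth.exists_algebraicIndepOn {K : Type u} [Field K] {σ A : Type*}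
    [CommRing A] [Algebra K A] [Algebra (MvPolynomial σ K) A]
    [IsScalarTower K (MvPolynomial σ K) A] [Algebra.FormallySmooth (MvPolynomial σ K) A]
    (P : ∀ (L : Type u) [Field L] [Algebra K L], Prop) (hK : P K)
    (hP : ∀ (L : Type u) [Field L] [Algebra K L], P L → P (FractionRing L⟦X⟧))
    (a : A →ₐ[K] K) (s : Finset σ) :
    ∃ (L : Type u) (_ : Field L) (_ : Algebra K L) (b : A →ₐ[K] L), P L ∧
      AlgebraicIndepOn K (fun i ↦ b (algebraMap (MvPolynomial σ K) A (MvPolynomial.X i)))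
        (s : Set σ) := by
  classical
  induction s using Finset.induction_on with
  | empty => exact ⟨K, _, _, a, hK, by
      rw [Finset.coe_empty]
      exact algebraicIndependent_empty_type⟩
  | insert i s hi ih =>
    obtain ⟨L, _, _, b, hL, hb⟩ := ih
    let t : σ → L := fun j ↦ b (algebraMap (MvPolynomial σ K) A (MvPolynomial.X j))
    -- Only coordinate `i` moves: the others stay in `L`, so those in `s` remain independent, while
    -- the new one becomes transcendental over all of `L`.
    let φ : MvPolynomial σ K →ₐ[K] L⟦X⟧ :=
      MvPolynomial.aeval fun j ↦ if j = i then X + C (t j) else C (t j)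
    have hφ : (constantCoeff (R := L)).comp φ.toRingHom =
        b.toRingHom.comp (algebraMap (MvPolynomial σ K) A) := by
      refine MvPolynomial.ringHom_ext (fun k ↦ ?_) fun j ↦ ?_
      · change constantCoeff (φ (algebraMap K _ k)) = b (algebraMap _ A (algebraMap K _ k))
        rw [φ.commutes, ← IsScalarTower.algebraMap_apply, b.commutes]
        exact constantCoeff_C (algebraMap K L k)
      · by_cases hj : j = i <;> simp [φ, hj, t]
    obtain ⟨c, hc⟩ := Algebra.FormallySmooth.exists_powerSeries_lift b.toRingHom φ.toRingHom hφ
    have hcK (k : K) : c (algebraMap K A k) = algebraMap K L⟦X⟧ k := by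
      rw [IsScalarTower.algebraMap_apply K (MvPolynomial σ K) A]
      exact (RingHom.congr_fun hc _).trans (φ.commutes k)
    have hcX (j : σ) : c (algebraMap (MvPolynomial σ K) A (.X j)) =
        if j = i then X + C (t j) else C (t j) :=
      (RingHom.congr_fun hc _).trans (MvPolynomial.aeval_X _ j)
    let c' : A →ₐ[K] FractionRing L⟦X⟧ :=
      (IsScalarTower.toAlgHom K L⟦X⟧ (FractionRing L⟦X⟧)).comp { c with commutes' := hcK }
    have hc' (j : σ) (hj : j ≠ i) : c' (algebraMap (MvPolynomial σ K) A (.X j)) =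
        IsScalarTower.toAlgHom K L (FractionRing L⟦X⟧) (t j) := by
      change algebraMap _ _ (c _) = _
      rw [hcX, if_neg hj]
      rfl
    refine ⟨FractionRing L⟦X⟧, _, _, c', hP L hL, ?_⟩
    rw [Finset.coe_insert]
    refine AlgebraicIndepOn.insert ?_ ?_
    · convert! hb.map' (algebraMap L (FractionRing L⟦X⟧)).injective
        (f := IsScalarTower.toAlgHom K L (FractionRing L⟦X⟧)) using 1
      ext1 j
      exact hc' j fun h ↦ hi (h ▸ j.2)
    · refine Transcendental.of_subalgebra_le_range (L := L) ?_ ?_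
      · rw [Algebra.adjoin_le_iff]
        rintro _ ⟨j, hj, rfl⟩
        exact ⟨t j, (hc' j fun h ↦ hi (h ▸ hj)).symm⟩
      · change Transcendental L (algebraMap _ _ (c _))
        rw [hcX, if_pos rfl]
        exact (transcendental_algebraMap_iff (IsFractionRing.injective L⟦X⟧ _)).mpr
          (PowerSeries.transcendental_X_add_C _)

/-- A smaller prime also contracts to zero, and a quasi-finite fibre has no strict inclusions of
primes. -/
theorem Algebra.QuasiFinite.mem_minimalPrimes {R A : Type*} [CommRing R]
    [CommRing A] [Algebra R A] [Algebra.QuasiFinite R A] (p : Ideal A) [p.IsPrime]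
    (h : p.under R = ⊥) : p ∈ minimalPrimes A := by
  refine ⟨⟨‹_›, bot_le⟩, fun q hq hqp ↦ ?_⟩
  have := hq.1
  refine (Algebra.QuasiFinite.eq_of_le_of_under_eq (R := R) q p hqp ?_).ge
  rw [h, eq_bot_iff, ← h]
  exact Ideal.comap_mono hqp

theorem PrimeSpectrum.mem_of_mem_minimalPrimes_of_dense {A : Type*} [CommRing A]
    [IsNoetherianRing A]
    (p : PrimeSpectrum A) (hp : p.asIdeal ∈ minimalPrimes A) {U : Set (PrimeSpectrum A)}
    (hU : IsOpen U) (hU' : Dense U) : p ∈ U := by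
  have hZ : closure {p} ∈ irreducibleComponents (PrimeSpectrum A) := by
    rw [← vanishingIdeal_mem_minimalPrimes]
    simpa using hp
  have hfin := TopologicalSpace.NoetherianSpace.finite_irreducibleComponents (α := PrimeSpectrum A)
  have hcl := closure_sUnion_irreducibleComponents_sdiff_singleton hfin _ hZ
  -- `V` is open because there are finitely many components; its points specialize `p`, and open
  -- sets are stable under generization.
  set V : Set (PrimeSpectrum A) := (⋃₀ (irreducibleComponents (PrimeSpectrum A) \ {closure {p}}))ᶜ
  have hV : IsOpen V := by
    rw [isOpen_compl_iff, Set.sUnion_eq_biUnion]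
    exact hfin.sdiff.isClosed_biUnion fun W hW ↦ isClosed_of_mem_irreducibleComponents W hW.1
  have hne : V.Nonempty := closure_nonempty_iff.mp (hcl ▸ ⟨p, subset_closure rfl⟩)
  obtain ⟨q, hqV, hqU⟩ := hU'.inter_open_nonempty V hV hne
  exact (specializes_iff_mem_closure.mpr (hcl ▸ subset_closure hqV)).mem_open hU hqU

theorem RingHom.Smooth.exists_isStandardSmooth_away {K A : Type u} [Field K] [CommRing A]
    {i : K →+* A} (hi : i.Smooth) {F : Type*} [Field F] (a : A →+* F) :
    ∃ t : A, a t ≠ 0 ∧ ((algebraMap A (Localization.Away t)).comp i).IsStandardSmooth := by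
  obtain ⟨s, hs, h⟩ := RingHom.smooth_iff_locally_isStandardSmooth.mp hi
  by_contra! H
  have : Ideal.span s ≤ RingHom.ker a :=
    Ideal.span_le.mpr fun t ht ↦ by_contra fun h0 ↦ H t h0 (h t ht)
  exact RingHom.ker_ne_top a (top_le_iff.mp (hs ▸ this))

/-- By the valuative criterion, a proper `K`-scheme with an `L((X))`-point has an `L`-point. -/
theorem AlgebraicGeometry.exists_point_of_fractionRing_powerSeries {K : Type u} [Field K]
    {Y : Scheme.{u}}
    (p : Y ⟶ Spec (.of K)) [IsProper p] (L : Type u) [Field L] [Algebra K L]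
    (h : ∃ y : Spec (.of (FractionRing L⟦X⟧)) ⟶ Y,
      y ≫ p = Spec.map (CommRingCat.ofHom (algebraMap K (FractionRing L⟦X⟧)))) :
    ∃ y : Spec (.of L) ⟶ Y, y ≫ p = Spec.map (CommRingCat.ofHom (algebraMap K L)) := by
  obtain ⟨y, hy⟩ := h
  have hp : ValuativeCriterion p := by
    have : IsProper p := inferInstance
    rw [IsProper.eq_valuativeCriterion] at this
    exact this.1.1.1
  let S : ValuativeCommSq p :=
    { R := L⟦X⟧
      K := FractionRing L⟦X⟧
      i₁ := y
      i₂ := Spec.map (CommRingCat.ofHom (algebraMap K L⟦X⟧))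
      commSq := ⟨by
        rw [hy, ← Spec.map_comp, ← CommRingCat.ofHom_comp, ← IsScalarTower.algebraMap_eq]⟩ }
  obtain ⟨⟨l, -, hl⟩⟩ := (hp.existence S).exists_lift
  refine ⟨Spec.map (CommRingCat.ofHom constantCoeff) ≫ l, ?_⟩
  rw [Category.assoc, hl, ← Spec.map_comp, ← CommRingCat.ofHom_comp]
  congr 2

/-- A `K`-scheme has a standard smooth affine neighbourhood of any smooth `K`-point. -/
theorem AlgebraicGeometry.Scheme.Hom.IsSmoothAt.exists_isStandardSmooth {K : Type u} [Field K]
    {X : Scheme.{u}} {q : X ⟶ Spec (.of K)} {x : Spec (.of K) ⟶ X} (hx : x ≫ q = 𝟙 _)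
    (h : q.IsSmoothAt (x (IsLocalRing.closedPoint K))) :
    ∃ (A : Type u) (_ : CommRing A) (i : K →+* A) (a : A →+* K) (j : Spec (.of A) ⟶ X),
      i.IsStandardSmooth ∧ a.comp i = RingHom.id K ∧ IsOpenImmersion j ∧
        j ≫ q = Spec.map (CommRingCat.ofHom i) := by
  obtain ⟨V, hxV, hV⟩ := h
  obtain ⟨W, hW, hxW, hWV⟩ := exists_isAffineOpen_mem_and_subset hxV
  let B := Γ(X, W)
  let j : Spec B ⟶ X := hW.fromSpec
  have hjV : Set.range j ⊆ Set.range V.ι := by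
    rw [hW.range_fromSpec, Scheme.Opens.range_ι]
    exact hWV
  have hj : Smooth (j ≫ q) := by
    rw [← IsOpenImmersion.lift_fac V.ι j hjV, Category.assoc]
    have : IsOpenImmersion (IsOpenImmersion.lift V.ι j hjV ≫ V.ι) := by
      rw [IsOpenImmersion.lift_fac]; infer_instance
    have : IsOpenImmersion (IsOpenImmersion.lift V.ι j hjV) := .of_comp _ V.ι
    infer_instance
  obtain ⟨i, hi⟩ := Spec.map_surjective (j ≫ q)
  rw [← hi, HasRingHomProperty.Spec_iff (P := @Smooth)] at hj
  have hxj : Set.range x ⊆ Set.range j := by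
    rw [hW.range_fromSpec]
    rintro _ ⟨s, rfl⟩
    rwa [Subsingleton.elim s (IsLocalRing.closedPoint K)]
  obtain ⟨a, ha⟩ := Spec.map_surjective (IsOpenImmersion.lift j x hxj)
  have hai : i ≫ a = 𝟙 _ := by
    apply Spec.map_injective
    rw [Spec.map_comp, ha, hi, IsOpenImmersion.lift_fac_assoc, hx, Spec.map_id]
  obtain ⟨t, ht, h⟩ := hj.exists_isStandardSmooth_away a.hom
  refine ⟨Localization.Away t, _, _, IsLocalization.Away.lift t (g := a.hom) ht.isUnit,
    Spec.map (CommRingCat.ofHom (algebraMap B (Localization.Away t))) ≫ j, h, ?_, ?_, ?_⟩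
  · rw [← RingHom.comp_assoc, IsLocalization.Away.lift_comp]
    exact congr_arg CommRingCat.Hom.hom hai
  · have : IsOpenImmersion (Spec.map (CommRingCat.ofHom (algebraMap B (Localization.Away t)))) :=
      IsOpenImmersion.of_isLocalization t
    infer_instance
  · rw [Category.assoc, ← hi, ← Spec.map_comp]
    rfl

/-- A field-valued point of an étale algebra over `K[X₁, …, Xₙ]` lying over the generic point of affine
space is contained in every dense open set. -/
theorem Algebra.Etale.ker_mem_of_dense {σ K A L : Type*} [Finite σ] [Field K] [CommRing A]
    [Algebra (MvPolynomial σ K) A] [Algebra.Etale (MvPolynomial σ K) A] [Field L] (b : A →+* L)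
    (hb : Function.Injective (b.comp (algebraMap (MvPolynomial σ K) A)))
    {U : Set (PrimeSpectrum A)} (hU : IsOpen U) (hU' : Dense U) :
    PrimeSpectrum.comap b (IsLocalRing.closedPoint L) ∈ U := by
  have : IsNoetherianRing A := Algebra.FiniteType.isNoetherianRing (MvPolynomial σ K) A
  refine PrimeSpectrum.mem_of_mem_minimalPrimes_of_dense _ ?_ hU hU'
  refine Algebra.QuasiFinite.mem_minimalPrimes (R := MvPolynomial σ K) _ ?_
  rw [Ideal.under, PrimeSpectrum.comap_asIdeal, Ideal.comap_comap]
  change Ideal.comap _ (IsLocalRing.maximalIdeal L) = ⊥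
  rw [IsLocalRing.maximalIdeal_eq_bot]
  exact (RingHom.injective_iff_ker_eq_bot _).mp hb

end

/-- **Lang–Nishimura theorem.** -/
theorem mainTheorem3 {K : Type u} [Field K] {X Y : Scheme.{u}}
    [X.Over (Spec (.of K))] [Y.Over (Spec (.of K))]
    (f : X ⤏ Y) (hf : f.IsOver (Spec (.of K)))
    (hX : ∃ x : X.RationalPoint K, (X ↘ Spec (.of K)).IsSmoothAt x.point)
    (hY : IsProper (Y ↘ Spec (.of K))) :
    Nonempty (Y.RationalPoint K) := by
  obtain ⟨f, hf, -⟩ := f.exists_partialMap_over (Spec (.of K))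
  obtain ⟨x, hx⟩ := hX
  obtain ⟨A, _, i, a, j, hi, hai, hj, hjq⟩ := hx.exists_isStandardSmooth x.hom_over
  obtain ⟨n, g, hgi, hg⟩ := hi.exists_etale_mvPolynomial
  algebraize [i, g]
  have : IsScalarTower K (MvPolynomial (Fin n) K) A := .of_algebraMap_eq' hgi.symm
  have : Algebra.Etale (MvPolynomial (Fin n) K) A := hg
  -- Stated as an implication, so that the valuative criterion carries it from `L` up to the Laurent
  -- series field.
  let P (L : Type u) [Field L] [Algebra K L] : Prop :=
    (∃ y : Spec (.of L) ⟶ Y,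
      y ≫ (Y ↘ Spec (.of K)) = Spec.map (CommRingCat.ofHom (algebraMap K L))) →
    Nonempty (Y.RationalPoint K)
  obtain ⟨L, _, _, b, hL, hb⟩ := Algebra.FormallySmooth.exists_algebraicIndepOn P
    (fun ⟨y, hy⟩ ↦ ⟨y, hy.trans (Spec.map_id _)⟩)
    (fun L _ _ hL h ↦ hL (exists_point_of_fractionRing_powerSeries _ L h))
    { a with commutes' := RingHom.congr_fun hai } (Finset.univ (α := Fin n))
  let z : Spec (.of L) ⟶ X := Spec.map (CommRingCat.ofHom b.toRingHom) ≫ j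
  have hbX : Function.Injective (b.toRingHom.comp (algebraMap (MvPolynomial (Fin n) K) A)) := by
    have hb' := hb.comp (fun k : Fin n ↦ ⟨k, Finset.mem_coe.mpr (Finset.mem_univ k)⟩)
      fun _ _ h ↦ congr_arg Subtype.val h
    have he : b.comp (IsScalarTower.toAlgHom K (MvPolynomial (Fin n) K) A) =
        MvPolynomial.aeval fun k ↦ b (algebraMap (MvPolynomial (Fin n) K) A (.X k)) := by
      ext k
      simp
    have hinj := algebraicIndependent_iff_injective_aeval.mp hb'
    exact (DFunLike.coe_injective.eq_iff.mpr he).symm ▸ hinj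
  have hzf : Set.range z ⊆ Set.range f.domain.ι := by
    rw [Scheme.Opens.range_ι]
    rintro _ ⟨s, rfl⟩
    rw [Subsingleton.elim s (IsLocalRing.closedPoint L)]
    exact Algebra.Etale.ker_mem_of_dense b.toRingHom hbX (f.domain.2.preimage j.continuous)
      (f.dense_domain.preimage j.isOpenEmbedding.isOpenMap)
  refine hL ⟨IsOpenImmersion.lift f.domain.ι z hzf ≫ f.hom, ?_⟩
  have hf' : f.hom ≫ (Y ↘ Spec (.of K)) = f.domain.ι ≫ (X ↘ Spec (.of K)) := hf.1
  rw [Category.assoc, hf', IsOpenImmersion.lift_fac_assoc, Category.assoc, hjq, ← Spec.map_comp,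
    ← CommRingCat.ofHom_comp]
  congr 2
  exact b.comp_algebraMap
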